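/- Let $\mathbb X,\mathbb Y$ be finite-dimensional real Hilbert spaces, $\varphi\colon\mathbb X\to\mathbb R$ locally Lipschitz continuous, $\Phi\colon\mathbb X\rightrightarrows\mathbb Y$ a set-valued mapping with closed graph, and $\bar y\in\mathbb Y$. Let $\bar x$ be a local minimizer of $$\min\{\varphi(x)\mid \bar y\in\Phi(x)\}$$ (in particular $\bar y\in\Phi(\bar x)$), let $\gamma\ge 1$ be real, and let $\mathbb S_{\mathbb X}$ be the unit sphere of $\mathbb X$. Notation. For a set $Q$ in a Euclidean space and $z\in Q$: $\mathcal T_Q(z)$ is the Bouligand tangent cone; $\widehat{\mathcal N}_Q(z)$ is the regular (Fréchet) normal cone, i.e. the set of $\eta$ with $\langle\eta,z'-z\rangle\le o(\|z'-z\|)$ for $z'\in Q$; $\mathcal N_Q(z)$ is the limiting normal cone, i.e. the set of limits of $\eta_k\in\widehat{\mathcal N}_Q(z_k)$ with $Q\ni z_k\to z$; all three are empty if $z\notin Q$. Moreover, $\partial\varphi(\bar x)=\{\eta\mid(\eta,-1)\in\mathcal N_{\operatorname{epi}\varphi}(\bar x,\varphi(\bar x))\}$, $D\Phi(\bar x,\bar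 y)(u)=\{v\mid (u,v)\in\mathcal T_{\operatorname{gph}\Phi}(\bar x,\bar y)\}$, $D^*\Phi(\bar x,\bar y)(y^*)=\{x^*\mid (x^*,-y^*)\in\mathcal N_{\operatorname{gph}\Phi}(\bar x,\bar y)\}$, and $\ker M=\{z\mid 0\in M(z)\}$ for a set-valued mapping $M$. For $u\in\mathbb S_{\mathbb X}$ and $v\in\mathbb Y$, the set $D^*_\gamma\Phi((\bar x,\bar y);(u,v))(y^*)$ consists of all $x^*\in\mathbb X$ for which there are sequences $u_k\to u$, $v_k\to v$, $t_k\searrow0$ (with $t_k>0$), $x_k^*\to x^*$, $y_k^*\to y^*$ such that, for all $k$, $$\Bigl(x_k^*,-\frac{y_k^*}{(t_k\|u_k\|)^{\gamma-1}}\Bigr)\in\widehat{\mathcal N}_{\operatorname{gph}\Phi}\bigl(\bar x+t_ku_k,\ \bar y+(t_k\|u_k\|)^\gamma v_k\bigr);$$ $\widetilde D^*_\gamma\Phi((\bar x,\bar y);(u,v))(y^*)$ is defined in the same way with the base point $(\bar x+t_ku_k,\bar y+t_kv_k)$. A direction $u\in\mathbb S_{\mathbb X}$ is critical at $\bar x$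 if there are $u_k\to u$, $v_k\to0$, $t_k\searrow0$ (with $t_k>0$) such that $(\bar x+t_ku_k,\bar y+t_kv_k)\in\operatorname{gph}\Phi$ for all $k$ and $\limsup_{k\to\infty}(\varphi(\bar x+t_ku_k)-\varphi(\bar x))/t_k\le0$. Assume that $$\ker D^*_\gamma\Phi((\bar x,\bar y);(u,0))\subseteq\{0\}\qquad\text{for every } u\in\ker D\Phi(\bar x,\bar y)\cap\mathbb S_{\mathbb X}$$ (in particular, this holds if each of these kernels equals $\{0\}$). Then at least one of the following alternatives holds: 1. $\bar x$ is M-stationary, i.e. there is $\lambda\in\mathbb Y$ with $0\in\partial\varphi(\bar x)+D^*\Phi(\bar x,\bar y)(\lambda)$; 2. there is a critical direction $u\in\mathbb S_{\mathbb X}$ at $\bar x$ with $0\in\partial\varphi(\bar x)+\widetilde D^*_\gamma\Phi((\bar x,\bar y);(u,0))(0)$; 3. there are a critical direction $u\in\mathbb S_{\mathbb X}$ at $\bar x$, some $v\in\mathbb Y$, and $\lambda\in\mathbb Y\setminus\{0\}$ with $\langle\lambda,v\rangle\ge0$ and $0\in\partial\varphi(\bar x)+D^*_\gamma\Phi((\bar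 x,\bar y);(u,v))(\lambda)$. -/

import Mathlib

open Filter Topology
open scoped Pointwise RealInnerProductSpace

noncomputable section

namespace VarAnalysis

/-! ### Cones to subsets of a Euclidean space -/

section Cones

variable {E : Type*} [NormedAddCommGroup E] [InnerProductSpace ℝ E]

/-- A sequence of positive reals tending to zero. -/
def PosNull (t : ℕ → ℝ) : Prop :=
  (∀ k, 0 < t k) ∧ Tendsto t atTop (𝓝 0)

/-- The Bouligand tangent cone to `Q` at `x`; it is empty for `x ∉ Q`. -/
def tangentCone (Q : Set E) (x : E) : Set E :=
  {d | x ∈ Q ∧ ∃ (dk : ℕ → E) (t : ℕ → ℝ), Tendsto dk atTop (𝓝 d) ∧ PosNull t ∧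
    ∀ k, x + t k • dk k ∈ Q}

/-- The regular (Fréchet) normal cone: `⟪η, x' - x⟫ ≤ o(‖x' - x‖)` for `x' ∈ Q`, `x' → x`;
it is empty for `x ∉ Q`. -/
def regularNormalCone (Q : Set E) (x : E) : Set E :=
  {η | x ∈ Q ∧ ∀ ε : ℝ, 0 < ε → ∀ᶠ x' in 𝓝[Q] x, ⟪η, x' - x⟫ ≤ ε * ‖x' - x‖}

/-- The limiting (Mordukhovich) normal cone; it is empty for `x ∉ Q`. -/
def limitingNormalCone (Q : Set E) (x : E) : Set E :=
  {η | x ∈ Q ∧ ∃ xk ηk : ℕ → E, Tendsto xk atTop (𝓝 x) ∧ Tendsto ηk atTop (𝓝 η) ∧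
    ∀ k, xk k ∈ Q ∧ ηk k ∈ regularNormalCone Q (xk k)}

end Cones

section Maps

variable {X Y : Type*} [NormedAddCommGroup X] [InnerProductSpace ℝ X]
  [NormedAddCommGroup Y] [InnerProductSpace ℝ Y]

/-- The pair `(x, y)` as an element of the Euclidean product space `X × Y`, whose inner product
is the sum of the inner products of the components. -/
abbrev pair (x : X) (y : Y) : WithLp 2 (X × Y) := WithLp.toLp 2 (x, y)

/-! ### Subdifferential -/

/-- The epigraph of a real-valued function. -/
def epi (φ : X → ℝ) : Set (WithLp 2 (X × ℝ)) := {p | φ p.fst ≤ p.snd}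

/-- The limiting (Mordukhovich) subdifferential of `φ` at `x`. -/
def limitingSubdifferential (φ : X → ℝ) (x : X) : Set X :=
  {η | pair η (-1 : ℝ) ∈ limitingNormalCone (epi φ) (pair x (φ x))}

/-! ### Set-valued mappings and their generalized derivatives -/

/-- The graph of a set-valued mapping. -/
def graph (Φ : X → Set Y) : Set (WithLp 2 (X × Y)) := {p | p.snd ∈ Φ p.fst}

/-- The kernel of a set-valued mapping. -/
def kernel (Φ : X → Set Y) : Set X := {x | (0 : Y) ∈ Φ x}

/-- The graphical derivative `DΦ(x, y)`. -/
def graphicalDerivative (Φ : X → Set Y) (x : X) (y : Y) : X → Set Y :=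
  fun u => {v | pair u v ∈ tangentCone (graph Φ) (pair x y)}

/-- The limiting coderivative `D*Φ(x, y)`. -/
def limitingCoderivative (Φ : X → Set Y) (x : X) (y : Y) : Y → Set X :=
  fun ys => {xs | pair xs (-ys) ∈ limitingNormalCone (graph Φ) (pair x y)}

/-- The pseudo-coderivative `D*_γ Φ((x, y); (u, v))` of order `γ` in direction `(u, v)`. -/
def pseudoCoderivative (γ : ℝ) (Φ : X → Set Y) (x : X) (y : Y) (u : X) (v : Y) : Y → Set X :=
  fun ys => {xs | ∃ (uk xsk : ℕ → X) (vk ysk : ℕ → Y) (t : ℕ → ℝ),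
    Tendsto uk atTop (𝓝 u) ∧ Tendsto vk atTop (𝓝 v) ∧ PosNull t ∧
    Tendsto xsk atTop (𝓝 xs) ∧ Tendsto ysk atTop (𝓝 ys) ∧
    ∀ k, pair (xsk k) (-(((t k * ‖uk k‖) ^ (γ - 1))⁻¹ • ysk k)) ∈
      regularNormalCone (graph Φ)
        (pair (x + t k • uk k) (y + ((t k * ‖uk k‖) ^ γ) • vk k))}

/-- Gfrerer's pseudo-coderivative of order `γ` in direction `(u, v)`; the difference to
`pseudoCoderivative` is the base point `(x + t u, y + t v)`. -/
def gfrererPseudoCoderivative (γ : ℝ) (Φ : X → Set Y) (x : X) (y : Y) (u : X) (v : Y) :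
    Y → Set X :=
  fun ys => {xs | ∃ (uk xsk : ℕ → X) (vk ysk : ℕ → Y) (t : ℕ → ℝ),
    Tendsto uk atTop (𝓝 u) ∧ Tendsto vk atTop (𝓝 v) ∧ PosNull t ∧
    Tendsto xsk atTop (𝓝 xs) ∧ Tendsto ysk atTop (𝓝 ys) ∧
    ∀ k, pair (xsk k) (-(((t k * ‖uk k‖) ^ (γ - 1))⁻¹ • ysk k)) ∈
      regularNormalCone (graph Φ) (pair (x + t k • uk k) (y + t k • vk k))}

/-! ### The optimization problem `min {φ(x) | ybar ∈ Φ(x)}` -/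

/-- The feasible set. -/
def feasibleSet (Φ : X → Set Y) (ybar : Y) : Set X := {x | ybar ∈ Φ x}

/-- `xbar` is a (feasible) local minimizer of the problem. -/
def IsLocalMinimizer (φ : X → ℝ) (Φ : X → Set Y) (ybar : Y) (xbar : X) : Prop :=
  xbar ∈ feasibleSet Φ ybar ∧ IsLocalMinOn φ (feasibleSet Φ ybar) xbar

/-- `xbar` is an M-stationary point of the problem. -/
def IsMStationary (φ : X → ℝ) (Φ : X → Set Y) (ybar : Y) (xbar : X) : Prop :=
  xbar ∈ feasibleSet Φ ybar ∧
    ∃ lam : Y, (0 : X) ∈ limitingSubdifferential φ xbar + limitingCoderivative Φ xbar ybar lam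

/-- `u` is a critical (unit) direction of the problem at the feasible point `xbar`. The upper
limit is taken in the extended reals. -/
def IsCriticalDirection (φ : X → ℝ) (Φ : X → Set Y) (ybar : Y) (xbar u : X) : Prop :=
  xbar ∈ feasibleSet Φ ybar ∧ u ∈ Metric.sphere (0 : X) 1 ∧
    ∃ (uk : ℕ → X) (vk : ℕ → Y) (t : ℕ → ℝ),
      Tendsto uk atTop (𝓝 u) ∧ Tendsto vk atTop (𝓝 0) ∧ PosNull t ∧
      (∀ k, pair (xbar + t k • uk k) (ybar + t k • vk k) ∈ graph Φ) ∧
      limsup (fun k => (((φ (xbar + t k • uk k) - φ xbar) / t k : ℝ) : EReal)) atTop ≤ 0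

end Maps

end VarAnalysis

end

open Filter Topology
open scoped Pointwise RealInnerProductSpace

namespace VarAnalysis

/-! ### Regular normals from quadratic bounds -/

section Normals

variable {E : Type*} [NormedAddCommGroup E] [InnerProductSpace ℝ E]

/-! Penalize the constraint `w ∈ Φ z`, `w = ybar` by `c / 2 * ‖w - ybar‖ ^ 2`, and give `φ` its own
variable `x'`, tied to `z` by `c ^ 2 / 2 * ‖z - x'‖ ^ 2`. The decoupling replaces a fuzzy sum rule:
minimality in `x'` and in `(z, w)` separately gives a regular normal to the epigraph and one to the
graph, with multiplier `c • (w - ybar)` (`exists_penalty_point`, `exists_penalty_sequence`).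

If the multipliers have a bounded subsequence, passing to the limit gives M-stationarity. Otherwise
their norms tend to infinity, and comparing objective values bounds ‖multiplier‖ · ‖y_k - ybar‖ by a
constant times t_k = ‖x_k - xbar‖. Hence y_k - ybar = o(t_k), and the normalized x_k - xbar
accumulate at a critical direction.

In `exists_pseudoCoderivative_of_unbounded` the multipliers are scaled by t_k^(γ-1) and y_k - ybar
by t_k^(-γ), so the product of their norms stays bounded. Unbounded scaled multipliers contradict
the kernel hypothesis; a zero limit gives alternative 2; a nonzero limit bounds the scaled y_k -
ybar and gives alternative 3. -/

/-- Proximal normals are regular normals. -/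
theorem mem_regularNormalCone_of_quadratic {Q : Set E} {x η : E} (hx : x ∈ Q) (C : ℝ)
    (h : ∀ᶠ z in 𝓝[Q] x, ⟪η, z - x⟫ ≤ C * ‖z - x‖ ^ 2) : η ∈ regularNormalCone Q x := by
  refine ⟨hx, fun ε hε => ?_⟩
  have hlim : Tendsto (fun z : E => C * ‖z - x‖) (𝓝[Q] x) (𝓝 0) := by
    have : Continuous fun z : E => C * ‖z - x‖ := by fun_prop
    simpa using (this.tendsto x).mono_left nhdsWithin_le_nhds
  filter_upwards [h, hlim.eventually_lt_const hε] with z hz hz'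
  nlinarith [norm_nonneg (z - x)]

theorem smul_mem_regularNormalCone {Q : Set E} {x η : E} (h : η ∈ regularNormalCone Q x)
    {c : ℝ} (hc : 0 < c) : c • η ∈ regularNormalCone Q x := by
  refine ⟨h.1, fun ε hε => ?_⟩
  filter_upwards [h.2 (ε / c) (by positivity)] with z hz
  rw [real_inner_smul_left]
  calc c * ⟪η, z - x⟫ ≤ c * (ε / c * ‖z - x‖) := by gcongr
    _ = ε * ‖z - x‖ := by field_simp

theorem norm_sub_sq_expand (p q a : E) :
    ‖p - a‖ ^ 2 = ‖q - a‖ ^ 2 + 2 * ⟪q - a, p - q⟫ + ‖p - q‖ ^ 2 := by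
  rw [← sub_add_sub_cancel p q a, add_comm (p - q), norm_add_sq_real]

end Normals

/-- The dichotomy behind each case split: failing to diverge means being frequently bounded, and
properness then yields a convergent subsequence. -/
theorem tendsto_norm_atTop_or_subseq {E : Type*} [NormedAddCommGroup E] [ProperSpace E]
    (f : ℕ → E) :
    Tendsto (fun k => ‖f k‖) atTop atTop ∨
      ∃ (a : E) (σ : ℕ → ℕ), StrictMono σ ∧ Tendsto (f ∘ σ) atTop (𝓝 a) := by
  by_cases h : Tendsto (fun k => ‖f k‖) atTop atTop
  · exact Or.inl h
  · right
    rw [tendsto_atTop] at h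
    push Not at h
    obtain ⟨C, hC⟩ := h
    obtain ⟨a, -, σ, hσ, ha⟩ := tendsto_subseq_of_frequently_bounded
      (Metric.isBounded_ball (x := (0 : E)) (r := C))
      (hC.mono fun k hk => by simpa using hk)
    exact ⟨a, σ, hσ, ha⟩

section Pairs

variable {X Y : Type*} [NormedAddCommGroup X] [NormedAddCommGroup Y]

theorem continuous_pair : Continuous fun p : X × Y => pair p.1 p.2 :=
  WithLp.prod_continuous_toLp 2 X Y

theorem tendsto_pair {ι : Type*} {l : Filter ι} {a : ι → X} {b : ι → Y} {x : X} {y : Y}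
    (ha : Tendsto a l (𝓝 x)) (hb : Tendsto b l (𝓝 y)) :
    Tendsto (fun i => pair (a i) (b i)) l (𝓝 (pair x y)) :=
  (continuous_pair.tendsto (x, y)).comp (ha.prodMk_nhds hb)

theorem tendsto_fst_nhdsWithin (Q : Set (WithLp 2 (X × Y))) (x : X) (y : Y) :
    Tendsto (fun p : WithLp 2 (X × Y) => p.fst) (𝓝[Q] (pair x y)) (𝓝 x) :=
  ((WithLp.prod_continuous_ofLp 2 X Y).fst.tendsto (pair x y)).mono_left nhdsWithin_le_nhds

theorem tendsto_snd_nhdsWithin (Q : Set (WithLp 2 (X × Y))) (x : X) (y : Y) :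
    Tendsto (fun p : WithLp 2 (X × Y) => p.snd) (𝓝[Q] (pair x y)) (𝓝 y) :=
  ((WithLp.prod_continuous_ofLp 2 X Y).snd.tendsto (pair x y)).mono_left nhdsWithin_le_nhds

theorem norm_sq_eq_fst_add_snd (p : WithLp 2 (X × Y)) :
    ‖p‖ ^ 2 = ‖p.fst‖ ^ 2 + ‖p.snd‖ ^ 2 := WithLp.prod_norm_sq_eq_of_L2 p

end Pairs

variable {X Y : Type*} [NormedAddCommGroup X] [InnerProductSpace ℝ X]
  [NormedAddCommGroup Y] [InnerProductSpace ℝ Y]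

/-! ### First-order conditions and limits of normals -/

/-- A local minimizer of `φ` plus a quadratic yields a regular normal to the epigraph. -/
theorem pair_mem_regularNormalCone_epi {φ : X → ℝ} {x a : X} {m : ℝ} (hm : 0 ≤ m)
    (h : ∀ᶠ z in 𝓝 x, φ x + m / 2 * ‖x - a‖ ^ 2 ≤ φ z + m / 2 * ‖z - a‖ ^ 2) :
    pair (m • (a - x)) (-1 : ℝ) ∈ regularNormalCone (epi φ) (pair x (φ x)) := by
  refine mem_regularNormalCone_of_quadratic (show φ x ≤ φ x from le_rfl) (m / 2) ?_
  filter_upwards [(tendsto_fst_nhdsWithin (epi φ) x (φ x)).eventually h, self_mem_nhdsWithin]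
    with p hp hpe
  have hpe : φ p.fst ≤ p.snd := hpe
  rw [norm_sq_eq_fst_add_snd]
  simp only [WithLp.prod_inner_apply, WithLp.ofLp_sub, Prod.fst_sub, Prod.snd_sub,
    WithLp.sub_fst, WithLp.sub_snd, WithLp.toLp_fst, WithLp.toLp_snd]
  have e := norm_sub_sq_expand p.fst x a
  rw [real_inner_smul_left, ← neg_sub x a, inner_neg_left]
  have h1 : ⟪(-1 : ℝ), p.snd - φ x⟫ = -(p.snd - φ x) := by simp
  have h2 : 0 ≤ m / 2 * ‖p.snd - φ x‖ ^ 2 := by positivity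
  change m * -⟪x - a, p.fst - x⟫ + ⟪(-1 : ℝ), p.snd - φ x⟫ ≤ _
  rw [h1]
  nlinarith

/-- First-order condition for minimizing a quadratic over a set in the product space. -/
theorem pair_mem_regularNormalCone_of_isMin {Q : Set (WithLp 2 (X × Y))} {x a b : X} {y z : Y}
    {m c : ℝ} (hm : 0 ≤ m) (hc : 0 ≤ c) (hxy : pair x y ∈ Q)
    (h : ∀ᶠ p in 𝓝[Q] (pair x y),
      c / 2 * ‖y - z‖ ^ 2 + m / 2 * ‖x - a‖ ^ 2 + 1 / 2 * ‖x - b‖ ^ 2 ≤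
        c / 2 * ‖p.snd - z‖ ^ 2 + m / 2 * ‖p.fst - a‖ ^ 2 + 1 / 2 * ‖p.fst - b‖ ^ 2) :
    pair (-(x - b) - m • (x - a)) (-(c • (y - z))) ∈ regularNormalCone Q (pair x y) := by
  -- The sum of the three curvatures bounds the second-order remainder in both components at once.
  refine mem_regularNormalCone_of_quadratic hxy (c / 2 + m / 2 + 1 / 2) ?_
  filter_upwards [h] with p hp
  rw [norm_sq_eq_fst_add_snd]
  change ⟪-(x - b) - m • (x - a), p.fst - x⟫ + ⟪-(c • (y - z)), p.snd - y⟫ ≤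
    (c / 2 + m / 2 + 1 / 2) * (‖p.fst - x‖ ^ 2 + ‖p.snd - y‖ ^ 2)
  have e1 := norm_sub_sq_expand p.fst x a
  have e2 := norm_sub_sq_expand p.fst x b
  have e3 := norm_sub_sq_expand p.snd y z
  rw [inner_sub_left, inner_neg_left, inner_neg_left, real_inner_smul_left, real_inner_smul_left]
  rw [e1, e2, e3] at hp
  have h1 : 0 ≤ c * ‖p.fst - x‖ ^ 2 := by positivity
  have h2 : 0 ≤ m * ‖p.snd - y‖ ^ 2 := by positivity
  have h3 : 0 ≤ ‖p.snd - y‖ ^ 2 := by positivity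
  nlinarith

theorem mem_limitingSubdifferential_of_tendsto {φ : X → ℝ} (hφ : Continuous φ) {x ξ : X}
    {xk ξk : ℕ → X} (hx : Tendsto xk atTop (𝓝 x)) (hξ : Tendsto ξk atTop (𝓝 ξ))
    (h : ∀ k, pair (ξk k) (-1 : ℝ) ∈ regularNormalCone (epi φ) (pair (xk k) (φ (xk k)))) :
    ξ ∈ limitingSubdifferential φ x :=
  ⟨le_refl (φ x), _, _, tendsto_pair hx ((hφ.tendsto x).comp hx),
    tendsto_pair hξ tendsto_const_nhds, fun k => ⟨(h k).1, h k⟩⟩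

theorem mem_limitingCoderivative_of_tendsto {Φ : X → Set Y} {x xs : X} {y ys : Y}
    (hxy : y ∈ Φ x) {xk xsk : ℕ → X} {yk ysk : ℕ → Y}
    (hx : Tendsto xk atTop (𝓝 x)) (hy : Tendsto yk atTop (𝓝 y))
    (hxs : Tendsto xsk atTop (𝓝 xs)) (hys : Tendsto ysk atTop (𝓝 ys))
    (h : ∀ k, pair (xsk k) (-ysk k) ∈ regularNormalCone (graph Φ) (pair (xk k) (yk k))) :
    xs ∈ limitingCoderivative Φ x y ys :=
  ⟨hxy, _, _, tendsto_pair hx hy, tendsto_pair hxs hys.neg, fun k => ⟨(h k).1, h k⟩⟩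

theorem limsup_coe_nonpos {q e : ℕ → ℝ} (h : ∀ k, q k ≤ e k) (he : Tendsto e atTop (𝓝 0)) :
    limsup (fun k => (q k : EReal)) atTop ≤ 0 := by
  have h1 : Tendsto (fun k => (e k : EReal)) atTop (𝓝 0) := by
    exact_mod_cast (continuous_coe_real_ereal.tendsto 0).comp he
  rw [← h1.limsup_eq]
  exact limsup_le_limsup (Eventually.of_forall fun k => EReal.coe_le_coe_iff.2 (h k))

/-! ### Scaling of unbounded multipliers -/

/-- The rate analysis for normals with unbounded multipliers along a direction. -/
theorem exists_pseudoCoderivative_of_unbounded [ProperSpace Y] {Φ : X → Set Y} {x u xs : X}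
    {y : Y} {γ : ℝ}
    (hker : kernel (pseudoCoderivative γ Φ x y u 0) ⊆ {0})
    {xk xsk : ℕ → X} {yk lk : ℕ → Y} {M : ℝ}
    (hx : Tendsto xk atTop (𝓝 x)) (hpos : ∀ k, 0 < ‖xk k - x‖)
    (hu : Tendsto (fun k => ‖xk k - x‖⁻¹ • (xk k - x)) atTop (𝓝 u))
    (hy : Tendsto (fun k => ‖xk k - x‖⁻¹ • (yk k - y)) atTop (𝓝 0))
    (hxs : Tendsto xsk atTop (𝓝 xs))
    (hbound : ∀ k, ‖lk k‖ * ‖yk k - y‖ ≤ M * ‖xk k - x‖)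
    (hinner : ∀ k, 0 ≤ ⟪lk k, yk k - y⟫)
    (hn : ∀ k, pair (xsk k) (-lk k) ∈ regularNormalCone (graph Φ) (pair (xk k) (yk k))) :
    xs ∈ gfrererPseudoCoderivative γ Φ x y u 0 0 ∨
      ∃ v lam : Y, lam ≠ 0 ∧ 0 ≤ ⟪lam, v⟫ ∧ xs ∈ pseudoCoderivative γ Φ x y u v lam := by
  set t : ℕ → ℝ := fun k => ‖xk k - x‖ with ht
  have htnull : PosNull t := by
    refine ⟨hpos, ?_⟩
    have := (hx.sub_const x).norm
    simpa using this
  set uk : ℕ → X := fun k => (t k)⁻¹ • (xk k - x) with huk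
  have hnorm : ∀ k, t k * ‖uk k‖ = t k := fun k => by
    have := (hpos k).ne'
    simp only [huk, norm_smul, norm_inv, ht, norm_norm]
    field_simp
  have hxeq : ∀ k, x + t k • uk k = xk k := fun k => by
    simp only [huk]
    rw [smul_inv_smul₀ (hpos k).ne']
    abel
  -- The exponents γ - 1 and -γ add up to -1, which cancels the factor t in `hbound`.
  set m : ℕ → Y := fun k => t k ^ (γ - 1) • lk k with hm
  set w : ℕ → Y := fun k => (t k ^ γ)⁻¹ • (yk k - y) with hw
  have hyeq : ∀ k, y + t k ^ γ • w k = yk k := fun k => by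
    simp only [hw]
    rw [smul_inv_smul₀ (Real.rpow_pos_of_pos (hpos k) γ).ne']
    abel
  have hleq : ∀ k, (t k ^ (γ - 1))⁻¹ • m k = lk k := fun k =>
    inv_smul_smul₀ (Real.rpow_pos_of_pos (hpos k) _).ne' _
  have hscale : ∀ k, t k ^ (γ - 1) * (t k ^ γ)⁻¹ = (t k)⁻¹ := fun k => by
    have := hpos k
    rw [← Real.rpow_neg this.le, ← Real.rpow_add this, ← Real.rpow_neg_one]
    congr 1
    ring
  have hmw : ∀ k, ‖m k‖ * ‖w k‖ ≤ M := fun k => by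
    have h0 := hpos k
    have h1 := Real.rpow_pos_of_pos h0 (γ - 1)
    have h2 := Real.rpow_pos_of_pos h0 γ
    have e1 : ‖m k‖ = t k ^ (γ - 1) * ‖lk k‖ := by
      simp only [hm, norm_smul]
      rw [Real.norm_of_nonneg h1.le]
    have e2 : ‖w k‖ = (t k ^ γ)⁻¹ * ‖yk k - y‖ := by
      simp only [hw, norm_smul, norm_inv]
      rw [Real.norm_of_nonneg h2.le]
    rw [e1, e2]
    calc _ = (t k ^ (γ - 1) * (t k ^ γ)⁻¹) * (‖lk k‖ * ‖yk k - y‖) := by ring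
      _ = (t k)⁻¹ * (‖lk k‖ * ‖yk k - y‖) := by rw [hscale]
      _ ≤ (t k)⁻¹ * (M * t k) := mul_le_mul_of_nonneg_left (hbound k) (inv_pos.2 h0).le
      _ = M := by have := (hpos k).ne'; simp only [ht]; field_simp
  have hmwi : ∀ k, 0 ≤ ⟪m k, w k⟫ := fun k => by
    simp only [hm, hw, real_inner_smul_left, real_inner_smul_right]
    have := hinner k
    have := (hpos k).le
    positivity
  rcases tendsto_norm_atTop_or_subseq m with hinf | ⟨lam, σ, hσ, hlam⟩
  · exfalso
    have hbdd : ∃ (a : Y) (σ : ℕ → ℕ), StrictMono σ ∧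
        Tendsto ((fun k => ‖m k‖⁻¹ • m k) ∘ σ) atTop (𝓝 a) := by
      obtain ⟨a, -, σ, hσ, ha⟩ := tendsto_subseq_of_bounded
        (Metric.isBounded_closedBall (x := (0 : Y)) (r := 1)) (x := fun k => ‖m k‖⁻¹ • m k)
        (fun k => by simpa [norm_smul] using inv_mul_le_one (a := ‖m k‖))
      exact ⟨a, σ, hσ, ha⟩
    obtain ⟨a, σ, hσ, ha⟩ := hbdd
    obtain ⟨N, hN⟩ := eventually_atTop.1 (hinf.eventually_gt_atTop 0)
    -- The pseudo-coderivative asks for normals at every index, so the finitely many possibly zero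
    -- `m` are dropped.
    set τ : ℕ → ℕ := fun k => σ (k + N) with hτdef
    have hτ : Tendsto τ atTop atTop := hσ.tendsto_atTop.comp (tendsto_add_atTop_nat N)
    have hmpos : ∀ k, 0 < ‖m (τ k)‖ := fun k =>
      hN _ ((Nat.le_add_left N k).trans (hσ.id_le _))
    have ha' : Tendsto (fun k => ‖m (τ k)‖⁻¹ • m (τ k)) atTop (𝓝 a) :=
      ha.comp (tendsto_add_atTop_nat N)
    have hinv : Tendsto (fun k => ‖m (τ k)‖⁻¹) atTop (𝓝 0) :=
      tendsto_inv_atTop_zero.comp (hinf.comp hτ)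
    have ha1 : ‖a‖ = 1 := by
      refine tendsto_nhds_unique ha'.norm (tendsto_const_nhds.congr fun k => ?_)
      rw [norm_smul, norm_inv, norm_norm, inv_mul_cancel₀ (hmpos k).ne']
    have hw0 : Tendsto (fun k => w (τ k)) atTop (𝓝 0) := by
      refine squeeze_zero_norm (a := fun k => M * ‖m (τ k)‖⁻¹) (fun k => ?_)
        (by simpa using hinv.const_mul M)
      rw [← div_eq_mul_inv, le_div_iff₀ (hmpos k), mul_comm]
      exact hmw _
    -- Dividing the normals by ‖m‖ sends their first components to zero while the multipliers tend
    -- to the unit vector `a`; the base direction is 0 because `w` tends to 0.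
    have hmem : a ∈ kernel (pseudoCoderivative γ Φ x y u 0) := by
      refine ⟨uk ∘ τ, fun k => ‖m (τ k)‖⁻¹ • xsk (τ k), w ∘ τ, fun k => ‖m (τ k)‖⁻¹ • m (τ k),
        t ∘ τ, hu.comp hτ, hw0, ⟨fun k => hpos _, htnull.2.comp hτ⟩, ?_, ha', fun k => ?_⟩
      · simpa using hinv.smul (hxs.comp hτ)
      · have := smul_mem_regularNormalCone (hn (τ k)) (inv_pos.2 (hmpos k))
        simp only [Function.comp]
        rw [hnorm, hxeq, hyeq, smul_comm, hleq]
        rw [← smul_neg]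
        exact this
    have : a = 0 := hker hmem
    simp [this] at ha1
  · have hσ' := hσ.tendsto_atTop
    by_cases h0 : lam = 0
    · left
      subst h0
      refine ⟨uk ∘ σ, xsk ∘ σ, (fun k => (t k)⁻¹ • (yk k - y)) ∘ σ, m ∘ σ, t ∘ σ, hu.comp hσ',
        hy.comp hσ', ⟨fun k => hpos _, htnull.2.comp hσ'⟩, hxs.comp hσ', hlam, fun k => ?_⟩
      simp only [Function.comp]
      rw [hnorm, hxeq, hleq, smul_inv_smul₀ (hpos _).ne', add_sub_cancel]
      exact hn _
    · right
      -- As `m` tends to a nonzero limit, the product bound `hmw` rules out divergence of `w`.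
      rcases tendsto_norm_atTop_or_subseq (w ∘ σ) with hinf | ⟨v, ρ, hρ, hv⟩
      · exfalso
        have h1 : Tendsto (fun k => ‖m (σ k)‖ * ‖w (σ k)‖) atTop atTop :=
          hlam.norm.pos_mul_atTop (norm_pos_iff.2 h0) hinf
        obtain ⟨k, hk⟩ := (h1.eventually_gt_atTop M).exists
        exact absurd (hmw (σ k)) (not_le.2 hk)
      · have hτ : Tendsto (σ ∘ ρ) atTop atTop := hσ'.comp hρ.tendsto_atTop
        have hl : Tendsto (m ∘ (σ ∘ ρ)) atTop (𝓝 lam) := hlam.comp hρ.tendsto_atTop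
        refine ⟨v, lam, h0, ge_of_tendsto' (hl.inner hv) fun k => hmwi _, uk ∘ (σ ∘ ρ),
          xsk ∘ (σ ∘ ρ), w ∘ (σ ∘ ρ), m ∘ (σ ∘ ρ), t ∘ (σ ∘ ρ), hu.comp hτ, hv,
          ⟨fun k => hpos _, htnull.2.comp hτ⟩, hxs.comp hτ, hl, fun k => ?_⟩
        simp only [Function.comp]
        rw [hnorm, hxeq, hyeq, hleq]
        exact hn _

/-! ### Decoupled penalization -/

/-- Solutions of the decoupled penalized problem, with their regular normals and estimates. -/
theorem exists_penalty_point [ProperSpace X] [ProperSpace Y] {φ : X → ℝ} {Φ : X → Set Y}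
    (hΦ : IsClosed (graph Φ)) {x : X} {y : Y} (hxy : y ∈ Φ x) {r L : ℝ} (hr : 0 < r) (hL : 0 ≤ L)
    (hLip : ∀ a ∈ Metric.closedBall x r, ∀ b ∈ Metric.closedBall x r, φ a - φ b ≤ L * ‖a - b‖)
    {c : ℝ} (hc : 0 < c) (hφ : Continuous φ) :
    ∃ (x' z : X) (w : Y), ‖x' - x‖ ≤ r ∧ ‖z - x‖ ≤ r ∧ w ∈ Φ z ∧
      φ x' + c / 2 * ‖w - y‖ ^ 2 + c ^ 2 / 2 * ‖z - x'‖ ^ 2 + 1 / 2 * ‖z - x‖ ^ 2 ≤ φ x ∧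
      c ^ 2 * ‖z - x'‖ ≤ 2 * L ∧
      (‖x' - x‖ < r → pair (c ^ 2 • (z - x')) (-1 : ℝ) ∈
        regularNormalCone (epi φ) (pair x' (φ x'))) ∧
      (‖z - x‖ < r → ‖w - y‖ < 1 →
        pair (-(z - x) - c ^ 2 • (z - x')) (-(c • (w - y))) ∈
          regularNormalCone (graph Φ) (pair z w)) := by
  set K : Set (X × X × Y) := {p | p.1 ∈ Metric.closedBall x r ∧ p.2.1 ∈ Metric.closedBall x r ∧
    p.2.2 ∈ Metric.closedBall y 1 ∧ p.2.2 ∈ Φ p.2.1} with hK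
  have hKeq : K = (Metric.closedBall x r ×ˢ Metric.closedBall x r ×ˢ Metric.closedBall y 1) ∩
      (fun p : X × X × Y => pair p.2.1 p.2.2) ⁻¹' graph Φ := by
    ext p
    exact ⟨fun h => ⟨⟨h.1, h.2.1, h.2.2.1⟩, h.2.2.2⟩, fun h => ⟨h.1.1, h.1.2.1, h.1.2.2, h.2⟩⟩
  have hKc : IsCompact K := by
    rw [hKeq]
    exact ((isCompact_closedBall x r).prod
      ((isCompact_closedBall x r).prod (isCompact_closedBall y 1))).inter_right
      (hΦ.preimage (continuous_pair.comp continuous_snd))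
  have hbase : (x, x, y) ∈ K := ⟨by simp [hr.le], by simp [hr.le], by simp, hxy⟩
  set f : X × X × Y → ℝ := fun p => φ p.1 + c / 2 * ‖p.2.2 - y‖ ^ 2 +
    c ^ 2 / 2 * ‖p.2.1 - p.1‖ ^ 2 + 1 / 2 * ‖p.2.1 - x‖ ^ 2 with hf
  have hfc : Continuous f := by
    have := hφ.comp (continuous_fst (X := X) (Y := X × Y))
    simp only [hf]
    fun_prop
  obtain ⟨⟨x', z, w⟩, ⟨h1, h2, h3, h4⟩, hmin⟩ := hKc.exists_isMinOn ⟨_, hbase⟩ hfc.continuousOn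
  simp only at h1 h2 h3 h4
  have hmin' : ∀ p ∈ K, f (x', z, w) ≤ f p := fun p hp => hmin hp
  refine ⟨x', z, w, mem_closedBall_iff_norm.1 h1, mem_closedBall_iff_norm.1 h2, h4, ?_, ?_, ?_, ?_⟩
  · simpa [hf] using hmin' _ hbase
  · have h := hmin' (z, z, w) ⟨h2, h2, h3, h4⟩
    simp only [hf, sub_self, norm_zero] at h
    have h5 := hLip z h2 x' h1
    rcases (norm_nonneg (z - x')).eq_or_lt with h0 | h0
    · rw [← h0]; linarith
    · refine le_of_mul_le_mul_right ?_ h0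
      nlinarith
  · intro hlt
    refine pair_mem_regularNormalCone_epi (by positivity) ?_
    filter_upwards [Metric.isOpen_ball.mem_nhds (mem_ball_iff_norm.2 hlt)] with q hq
    have h := hmin' (q, z, w) ⟨Metric.ball_subset_closedBall hq, h2, h3, h4⟩
    simp only [hf] at h
    rw [norm_sub_rev x' z, norm_sub_rev q z]
    linarith
  · intro hlt hlt'
    refine pair_mem_regularNormalCone_of_isMin (by positivity) hc.le h4 ?_
    filter_upwards [(tendsto_fst_nhdsWithin (graph Φ) z w).eventually
        (Metric.isOpen_ball.mem_nhds (mem_ball_iff_norm.2 hlt)),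
      (tendsto_snd_nhdsWithin (graph Φ) z w).eventually
        (Metric.isOpen_ball.mem_nhds (mem_ball_iff_norm.2 hlt')), self_mem_nhdsWithin]
      with p hp1 hp2 hp
    have h := hmin' (x', p.fst, p.snd) ⟨h1, Metric.ball_subset_closedBall hp1,
      Metric.ball_subset_closedBall hp2, hp⟩
    simp only [hf] at h
    linarith

/-- The coupling weight c² exceeds the penalty weight c so that decoupling costs only L²/c², small
enough to be absorbed once the multipliers have norm at least 1. -/
theorem exists_penalty_sequence [ProperSpace X] [ProperSpace Y] {φ : X → ℝ}
    (hφ : LocallyLipschitz φ) {Φ : X → Set Y} (hΦ : IsClosed (graph Φ)) {x : X} {y : Y}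
    (hmin : IsLocalMinimizer φ Φ y x) :
    ∃ (L : ℝ) (c : ℕ → ℝ) (ξ : X) (ξk xk : ℕ → X) (yk : ℕ → Y), 0 ≤ L ∧ (∀ k, 0 < c k) ∧
      Tendsto c atTop atTop ∧ ξ ∈ limitingSubdifferential φ x ∧ Tendsto ξk atTop (𝓝 ξ) ∧
      Tendsto xk atTop (𝓝 x) ∧ Tendsto yk atTop (𝓝 y) ∧
      (∀ k, pair (-(xk k - x) - ξk k) (-(c k • (yk k - y))) ∈
        regularNormalCone (graph Φ) (pair (xk k) (yk k))) ∧
      (∀ k, c k * ‖yk k - y‖ ^ 2 ≤ 2 * L * ‖xk k - x‖ + L ^ 2 / c k ^ 2) ∧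
      (∀ k, φ (xk k) - φ x ≤ L ^ 2 / c k ^ 2) := by
  have hφc : Continuous φ := hφ.continuous
  obtain ⟨K, s, hs, hK⟩ := hφ x
  obtain ⟨r, hr, hrs⟩ := Metric.nhds_basis_closedBall.mem_iff.1
    (inter_mem hs (mem_nhdsWithin_iff_eventually.1 hmin.2))
  have hLip : ∀ a ∈ Metric.closedBall x r, ∀ b ∈ Metric.closedBall x r,
      φ a - φ b ≤ K * ‖a - b‖ := fun a ha b hb => by
    have h := hK.dist_le_mul a (hrs ha).1 b (hrs hb).1
    rw [dist_eq_norm, dist_eq_norm] at h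
    exact (le_abs_self _).trans h
  have hloc : ∀ a ∈ Metric.closedBall x r, y ∈ Φ a → φ x ≤ φ a := fun a ha hfa => (hrs ha).2 hfa
  set L : ℝ := (K : ℝ) with hLdef
  have hL : 0 ≤ L := K.2
  set d : ℕ → ℝ := fun k => (k : ℝ) + 1 with hd
  have hdpos : ∀ k, 0 < d k := fun k => by positivity
  have hdtop : Tendsto d atTop atTop := tendsto_natCast_atTop_atTop.atTop_add tendsto_const_nhds
  choose x' z w hx' hz hw hval hslope hepi hgr using
    fun k => exists_penalty_point hΦ hmin.1 hr hL hLip (hdpos k) hφc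
  have hmem' : ∀ k, x' k ∈ Metric.closedBall x r := fun k => mem_closedBall_iff_norm.2 (hx' k)
  have hmem : ∀ k, z k ∈ Metric.closedBall x r := fun k => mem_closedBall_iff_norm.2 (hz k)
  have hxr : x ∈ Metric.closedBall x r := by simp [hr.le]
  have hdinv : Tendsto (fun k => (d k)⁻¹) atTop (𝓝 0) := tendsto_inv_atTop_zero.comp hdtop
  have hs0 : Tendsto (fun k => z k - x' k) atTop (𝓝 0) := by
    refine squeeze_zero_norm (a := fun k => 2 * L * ((d k)⁻¹ * (d k)⁻¹)) (fun k => ?_)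
      (by simpa using (hdinv.mul hdinv).const_mul (2 * L))
    have := hdpos k
    rw [← mul_inv, ← div_eq_mul_inv, le_div_iff₀ (by positivity)]
    linarith [hslope k]
  have hy0 : Tendsto w atTop (𝓝 y) := by
    have h1 : Tendsto (fun k => ‖w k - y‖ ^ 2) atTop (𝓝 0) := by
      refine squeeze_zero (g := fun k => 2 * L * r * (d k)⁻¹) (fun k => by positivity)
        (fun k => ?_) (by simpa using hdinv.const_mul (2 * L * r))
      have h2 := hLip x hxr (x' k) (hmem' k)
      rw [norm_sub_rev] at h2
      have h3 := mul_le_mul_of_nonneg_left (hx' k) hL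
      have h4 : 0 ≤ d k ^ 2 / 2 * ‖z k - x' k‖ ^ 2 := by positivity
      have h5 : 0 ≤ 1 / 2 * ‖z k - x‖ ^ 2 := by positivity
      rw [← div_eq_mul_inv, le_div_iff₀ (hdpos k)]
      linarith [hval k]
    rw [tendsto_iff_norm_sub_tendsto_zero]
    simpa [Real.sqrt_sq (norm_nonneg _)] using h1.sqrt
  have hξb : ∀ k, ‖d k ^ 2 • (z k - x' k)‖ ≤ 2 * L := fun k => by
    rw [norm_smul, Real.norm_of_nonneg (by positivity)]
    exact hslope k
  obtain ⟨⟨x0, ξ⟩, -, σ, hσ, hlim⟩ := tendsto_subseq_of_bounded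
    ((Metric.isBounded_closedBall (x := x) (r := r)).prod
      (Metric.isBounded_closedBall (x := (0 : X)) (r := 2 * L)))
    (x := fun k => (z k, d k ^ 2 • (z k - x' k)))
    (fun k => ⟨hmem k, by simpa using hξb k⟩)
  have hσ' := hσ.tendsto_atTop
  have hz0 : Tendsto (fun k => z (σ k)) atTop (𝓝 x0) := (continuous_fst.tendsto _).comp hlim
  have hξ : Tendsto (fun k => d (σ k) ^ 2 • (z (σ k) - x' (σ k))) atTop (𝓝 ξ) :=
    (continuous_snd.tendsto _).comp hlim
  have hx0' : Tendsto (fun k => x' (σ k)) atTop (𝓝 x0) := by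
    simpa using hz0.sub (hs0.comp hσ')
  -- The limit is feasible and φ x0 + ‖x0 - x‖²/2 ≤ φ x; local minimality leaves no room for the
  -- quadratic term.
  have hx0 : x0 = x := by
    have hfeas : y ∈ Φ x0 := hΦ.mem_of_tendsto (tendsto_pair hz0 (hy0.comp hσ'))
      (Eventually.of_forall fun k => hw (σ k))
    have hball : x0 ∈ Metric.closedBall x r :=
      Metric.isClosed_closedBall.mem_of_tendsto hz0 (Eventually.of_forall fun k => hmem (σ k))
    have h1 : φ x0 + 1 / 2 * ‖x0 - x‖ ^ 2 ≤ φ x := by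
      refine le_of_tendsto' (((hφc.tendsto x0).comp hx0').add
        (((hz0.sub_const x).norm.pow 2).const_mul (1 / 2))) fun k => ?_
      have h2 := hval (σ k)
      have h3 := (hdpos (σ k)).le
      have h4 : 0 ≤ d (σ k) ^ 2 / 2 * ‖z (σ k) - x' (σ k)‖ ^ 2 := by positivity
      have h5 : 0 ≤ d (σ k) / 2 * ‖w (σ k) - y‖ ^ 2 := by positivity
      simp only [Function.comp]
      linarith
    have h2 := hloc x0 hball hfeas
    have h3 : ‖x0 - x‖ ^ 2 = 0 := le_antisymm (by linarith) (by positivity)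
    exact sub_eq_zero.1 (norm_eq_zero.1 (pow_eq_zero_iff two_ne_zero |>.1 h3))
  subst hx0
  -- Beyond `N` the minimizers are interior to the balls, so the first-order conditions apply.
  obtain ⟨N, hN⟩ := eventually_atTop.1
    (((hx0'.eventually (Metric.ball_mem_nhds x0 hr)).and
      (hz0.eventually (Metric.ball_mem_nhds x0 hr))).and
      ((hy0.comp hσ').eventually (Metric.ball_mem_nhds y one_pos)))
  have hτ : Tendsto (fun k => k + N) atTop atTop := tendsto_add_atTop_nat N
  refine ⟨L, fun k => d (σ (k + N)), ξ,
    fun k => d (σ (k + N)) ^ 2 • (z (σ (k + N)) - x' (σ (k + N))), fun k => z (σ (k + N)),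
    fun k => w (σ (k + N)), hL, fun k => hdpos _, (hdtop.comp hσ').comp hτ, ?_, hξ.comp hτ,
    hz0.comp hτ, (hy0.comp hσ').comp hτ, fun k => ?_, fun k => ?_, fun k => ?_⟩
  · refine mem_limitingSubdifferential_of_tendsto hφc (hx0'.comp hτ) (hξ.comp hτ) fun k => ?_
    exact hepi _ (mem_ball_iff_norm.1 (hN (k + N) (Nat.le_add_left _ _)).1.1)
  · have h := hN (k + N) (Nat.le_add_left _ _)
    exact hgr _ (mem_ball_iff_norm.1 h.1.2) (mem_ball_iff_norm.1 h.2)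
  all_goals
    set j := σ (k + N)
    have hdj := hdpos j
    have h1 := hval j
    -- Young's inequality: the coupling term pays for replacing `x'` by `z` in `φ`.
    have hyoung : 2 * L * ‖z j - x' j‖ ≤ L ^ 2 / d j ^ 2 + d j ^ 2 * ‖z j - x' j‖ ^ 2 := by
      have h3 : L ^ 2 / d j ^ 2 = (L / d j) ^ 2 := by rw [div_pow]
      have h4 := two_mul_le_add_sq (L / d j) (d j * ‖z j - x' j‖)
      calc 2 * L * ‖z j - x' j‖ = 2 * (L / d j) * (d j * ‖z j - x' j‖) := by
            field_simp
        _ ≤ (L / d j) ^ 2 + (d j * ‖z j - x' j‖) ^ 2 := h4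
        _ = _ := by rw [h3, mul_pow]
  · have h2 := hLip x0 hxr (x' j) (hmem' j)
    have h3 : ‖x0 - x' j‖ ≤ ‖z j - x0‖ + ‖z j - x' j‖ := by
      rw [norm_sub_rev (z j) x0]
      exact norm_sub_le_norm_sub_add_norm_sub x0 (z j) (x' j)
    have h4 := mul_le_mul_of_nonneg_left h3 hL
    have h5 : 0 ≤ 1 / 2 * ‖z j - x0‖ ^ 2 := by positivity
    linarith
  · have h2 := hLip (z j) (hmem j) (x' j) (hmem' j)
    have h5 : 0 ≤ 1 / 2 * ‖z j - x0‖ ^ 2 := by positivity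
    have h6 : 0 ≤ d j / 2 * ‖w j - y‖ ^ 2 := by positivity
    have h7 : 0 ≤ L ^ 2 / d j ^ 2 := by positivity
    linarith

end VarAnalysis

/-! ### The three alternatives -/

open VarAnalysis in
theorem corollary4p8 {X Y : Type*}
    [NormedAddCommGroup X] [InnerProductSpace ℝ X] [FiniteDimensional ℝ X]
    [NormedAddCommGroup Y] [InnerProductSpace ℝ Y] [FiniteDimensional ℝ Y]
    (φ : X → ℝ) (hφ : LocallyLipschitz φ)
    (Φ : X → Set Y) (hΦ : IsClosed (VarAnalysis.graph Φ))
    (xbar : X) (ybar : Y) (hmin : VarAnalysis.IsLocalMinimizer φ Φ ybar xbar)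
    (γ : ℝ) (hγ : 1 ≤ γ)
    (hker : ∀ u ∈ VarAnalysis.kernel (VarAnalysis.graphicalDerivative Φ xbar ybar) ∩
        Metric.sphere (0 : X) 1,
      VarAnalysis.kernel (VarAnalysis.pseudoCoderivative γ Φ xbar ybar u 0) ⊆ {0}) :
    VarAnalysis.IsMStationary φ Φ ybar xbar ∨
    (∃ u : X, VarAnalysis.IsCriticalDirection φ Φ ybar xbar u ∧
      (0 : X) ∈ VarAnalysis.limitingSubdifferential φ xbar +
        VarAnalysis.gfrererPseudoCoderivative γ Φ xbar ybar u 0 0) ∨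
    (∃ (u : X) (v lam : Y), VarAnalysis.IsCriticalDirection φ Φ ybar xbar u ∧
      lam ≠ 0 ∧ 0 ≤ ⟪lam, v⟫ ∧
      (0 : X) ∈ VarAnalysis.limitingSubdifferential φ xbar +
        VarAnalysis.pseudoCoderivative γ Φ xbar ybar u v lam) := by
  have : ProperSpace X := FiniteDimensional.proper_real X
  have : ProperSpace Y := FiniteDimensional.proper_real Y
  obtain ⟨L, c, ξ, ξk, xk, yk, hL, hc, hctop, hξ, hξk, hxk, hyk, hn, hest, hval⟩ :=
    exists_penalty_sequence hφ hΦ hmin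
  have hxs : Tendsto (fun k => -(xk k - xbar) - ξk k) atTop (𝓝 (-ξ)) := by
    simpa using (hxk.sub_const xbar).neg.sub hξk
  have hfeas : ybar ∈ Φ xbar := hmin.1
  rcases tendsto_norm_atTop_or_subseq (fun k => c k • (yk k - ybar)) with hinf | ⟨lam, σ, hσ, hlam⟩
  swap
  · have hσ' := hσ.tendsto_atTop
    exact Or.inl ⟨hfeas, lam, Set.mem_add.2 ⟨ξ, hξ, -ξ,
      mem_limitingCoderivative_of_tendsto hfeas (hxk.comp hσ') (hyk.comp hσ') (hxs.comp hσ') hlam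
        fun k => hn (σ k), add_neg_cancel ξ⟩⟩
  right
  have hgood : ∀ᶠ k in atTop, 1 ≤ ‖c k • (yk k - ybar)‖ ∧ 2 * L ^ 2 ≤ c k :=
    (hinf.eventually_ge_atTop 1).and (hctop.eventually_ge_atTop _)
  obtain ⟨N, hN⟩ := eventually_atTop.1 hgood
  -- the estimates beyond the index `N`
  have hnormeq : ∀ k, ‖c k • (yk k - ybar)‖ = c k * ‖yk k - ybar‖ := fun k => by
    rw [norm_smul, Real.norm_of_nonneg (hc k).le]
  -- Multiplying by ‖multiplier‖² ≥ 1 turns the error into a multiple of the penalty term; c ≥ 2L²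
  -- makes the factor L²/c at most 1/2, so `hrate` can absorb it.
  have hinvsq : ∀ k, N ≤ k → L ^ 2 / c k ^ 2 ≤ L ^ 2 / c k * (c k * ‖yk k - ybar‖ ^ 2) := by
    intro k hk
    have h1 := (hN k hk).1
    rw [hnormeq] at h1
    have h2 := hc k
    have h3 : L ^ 2 / c k * (c k * ‖yk k - ybar‖ ^ 2) =
      L ^ 2 / c k ^ 2 * (c k * ‖yk k - ybar‖) ^ 2 := by field_simp
    rw [h3]
    exact le_mul_of_one_le_right (by positivity) (one_le_pow₀ h1)
  have hrate : ∀ k, N ≤ k → c k * ‖yk k - ybar‖ ^ 2 ≤ 4 * L * ‖xk k - xbar‖ := by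
    intro k hk
    have h1 : L ^ 2 / c k ≤ 1 / 2 := by
      rw [div_le_iff₀ (hc k)]
      linarith [(hN k hk).2]
    have h2 := hc k
    have h3 : 0 ≤ c k * ‖yk k - ybar‖ ^ 2 := by positivity
    have h4 := mul_le_mul_of_nonneg_right h1 h3
    linarith [hest k, hinvsq k hk]
  have hpos : ∀ k, N ≤ k → 0 < ‖xk k - xbar‖ := by
    intro k hk
    have h1 := (hN k hk).1
    rw [hnormeq] at h1
    have h2 : 0 < ‖yk k - ybar‖ := by
      by_contra h
      have h0 := le_antisymm (not_lt.1 h) (norm_nonneg _)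
      rw [h0] at h1
      norm_num at h1
    have h3 := hc k
    have h4 : 0 < c k * ‖yk k - ybar‖ ^ 2 := by positivity
    by_contra h
    have h0 := le_antisymm (not_lt.1 h) (norm_nonneg _)
    have h5 := hrate k hk
    rw [h0] at h5
    linarith
  obtain ⟨u, hu1, σ, hσ, hu⟩ := tendsto_subseq_of_bounded
    (Metric.isBounded_closedBall (x := (0 : X)) (r := 1))
    (x := fun k => ‖xk k - xbar‖⁻¹ • (xk k - xbar))
    (fun k => by simpa [norm_smul] using inv_mul_le_one (a := ‖xk k - xbar‖))
  set τ : ℕ → ℕ := fun k => σ (k + N) with hτdef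
  have hτ : Tendsto τ atTop atTop := hσ.tendsto_atTop.comp (tendsto_add_atTop_nat N)
  have hNτ : ∀ k, N ≤ τ k := fun k => (Nat.le_add_left N k).trans (hσ.id_le _)
  have hu' : Tendsto (fun k => ‖xk (τ k) - xbar‖⁻¹ • (xk (τ k) - xbar)) atTop (𝓝 u) :=
    hu.comp (tendsto_add_atTop_nat N)
  have hposτ : ∀ k, 0 < ‖xk (τ k) - xbar‖ := fun k => hpos _ (hNτ k)
  have hunit : u ∈ Metric.sphere (0 : X) 1 := by
    rw [mem_sphere_zero_iff_norm]
    refine tendsto_nhds_unique hu'.norm (tendsto_const_nhds.congr fun k => ?_)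
    rw [norm_smul, norm_inv, norm_norm, inv_mul_cancel₀ (hposτ k).ne']
  have hbound : ∀ k, ‖c (τ k) • (yk (τ k) - ybar)‖ * ‖yk (τ k) - ybar‖ ≤
      4 * L * ‖xk (τ k) - xbar‖ := fun k => by
    rw [hnormeq]
    linarith [hrate _ (hNτ k)]
  -- By `hbound` the quotient is at most 4L / ‖multiplier‖, and the multipliers diverge.
  have hy : Tendsto (fun k => ‖xk (τ k) - xbar‖⁻¹ • (yk (τ k) - ybar)) atTop (𝓝 0) := by
    refine squeeze_zero_norm (a := fun k => 4 * L * ‖c (τ k) • (yk (τ k) - ybar)‖⁻¹) (fun k => ?_)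
      (by simpa using (tendsto_inv_atTop_zero.comp (hinf.comp hτ)).const_mul (4 * L))
    have h1 : 0 < ‖c (τ k) • (yk (τ k) - ybar)‖ := one_pos.trans_le (hN _ (hNτ k)).1
    rw [norm_smul, norm_inv, norm_norm, ← div_eq_mul_inv, inv_mul_eq_div,
      div_le_div_iff₀ (hposτ k) h1, mul_comm]
    exact hbound k
  have hnull : PosNull fun k => ‖xk (τ k) - xbar‖ :=
    ⟨hposτ, by simpa using ((hxk.comp hτ).sub_const xbar).norm⟩
  have hxeq : ∀ k, xbar + ‖xk (τ k) - xbar‖ • ‖xk (τ k) - xbar‖⁻¹ • (xk (τ k) - xbar) =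
      xk (τ k) := fun k => by rw [smul_inv_smul₀ (hposτ k).ne', add_sub_cancel]
  have hyeq : ∀ k, ybar + ‖xk (τ k) - xbar‖ • ‖xk (τ k) - xbar‖⁻¹ • (yk (τ k) - ybar) =
      yk (τ k) := fun k => by rw [smul_inv_smul₀ (hposτ k).ne', add_sub_cancel]
  have hgraph : ∀ k, pair (xk (τ k)) (yk (τ k)) ∈ graph Φ := fun k => (hn (τ k)).1
  have hcrit : IsCriticalDirection φ Φ ybar xbar u := by
    refine ⟨hfeas, hunit, _, _, _, hu', hy, hnull, fun k => ?_, ?_⟩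
    · rw [hxeq, hyeq]
      exact hgraph k
    -- Chaining `hval`, `hinvsq` and `hrate` bounds the difference quotient of `φ` by 4L³/c.
    · refine limsup_coe_nonpos (e := fun k => 4 * L ^ 3 * (c (τ k))⁻¹) (fun k => ?_)
        (by simpa using (tendsto_inv_atTop_zero.comp (hctop.comp hτ)).const_mul (4 * L ^ 3))
      rw [hxeq, div_le_iff₀ (hposτ k)]
      have h1 := hc (τ k)
      calc φ (xk (τ k)) - φ xbar ≤ L ^ 2 / c (τ k) ^ 2 := hval _
        _ ≤ L ^ 2 / c (τ k) * (c (τ k) * ‖yk (τ k) - ybar‖ ^ 2) := hinvsq _ (hNτ k)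
        _ ≤ L ^ 2 / c (τ k) * (4 * L * ‖xk (τ k) - xbar‖) :=
          mul_le_mul_of_nonneg_left (hrate _ (hNτ k)) (by positivity)
        _ = _ := by ring
  have hker' := hker u ⟨⟨hfeas, _, _, tendsto_pair hu' hy, hnull, fun k => by
    have h1 : pair xbar ybar + ‖xk (τ k) - xbar‖ • pair (‖xk (τ k) - xbar‖⁻¹ • (xk (τ k) - xbar))
        (‖xk (τ k) - xbar‖⁻¹ • (yk (τ k) - ybar)) = pair (xk (τ k)) (yk (τ k)) := by
      change pair (xbar + ‖xk (τ k) - xbar‖ • ‖xk (τ k) - xbar‖⁻¹ • (xk (τ k) - xbar))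
        (ybar + ‖xk (τ k) - xbar‖ • ‖xk (τ k) - xbar‖⁻¹ • (yk (τ k) - ybar)) = _
      rw [hxeq, hyeq]
    rw [h1]
    exact hgraph k⟩, hunit⟩
  rcases exists_pseudoCoderivative_of_unbounded hker' (hxk.comp hτ) hposτ hu' hy (hxs.comp hτ)
    hbound (fun k => by
      simp only [real_inner_smul_left]
      exact mul_nonneg (hc _).le real_inner_self_nonneg) (fun k => hn (τ k))
    with h | ⟨v, lam, hlam, hv, h⟩
  · exact Or.inl ⟨u, hcrit, Set.mem_add.2 ⟨ξ, hξ, -ξ, h, add_neg_cancel ξ⟩⟩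
  · exact Or.inr ⟨u, v, lam, hcrit, hlam, hv, Set.mem_add.2 ⟨ξ, hξ, -ξ, h, add_neg_cancel ξ⟩⟩
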